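/- Let $G$ be a star on $k\ge 1$ vertices, that is, a graph with vertex set $V$, $|V|=k$, in which one vertex $c$ (the centre) is adjacent to all other vertices and there are no further edges. Choose an orientation of every edge of $G$, and let $\mathcal A_G$ be the automaton with alphabet $V$ whose states are the oriented edges $e=(x,y)$ of $G$ together with a sink $id$. The state $id$ fixes every word over $V$. The state $e=(x,y)$ acts on words over $V$ by $$e(xw)=y\,e(w),\qquad e(yw)=x\,w,\qquad e(zw)=z\,w\quad (z\in V\setminus\{x,y\}),$$ and fixes the empty word. For $n\ge 1$, let $\Gamma_n^G$ be the $n$-th Schreier graph of $\mathcal A_G$: its vertex set is $V^n$, and for every $u\in V^n$ and every state $q$ there is an edge, labelled by $q$, that joins $u$ and $q(u)$. For a finite connected graph $\Gamma$, let $W(\Gamma)$ be its Wiener index, that is, the sum of the distances $d_\Gamma(u,v)$ over all unordered pairs $\{u,v\}$ of vertices. Then, for every choice of the orientation and every $n\ge 1$, the graph $\Gamma_n^G$ is connected and $$W(\Gamma_n^G)=\frac{(k-1)^2(2k^2-2k-1)}{k^3(2k-1)}\cdot 2^n k^{2n}-\frac{(k-1)(k-2)}{k^2}\cdot k^{2n}+\frac{(k-1)(k-2)}{k^2(2k-1)}\cdot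 k^n .$$ -/

import Mathlib

namespace GraphAutomaton

/-- An invertible automaton with state set `Q` and alphabet `X`: a restriction map
`Q × X → Q` and an output map `Q × X → X` such that every state acts on the alphabet by a
permutation. -/
structure InvertibleAutomaton (Q X : Type*) where
  /-- the restriction map -/
  restr : Q → X → Q
  /-- the output map -/
  out : Q → Equiv.Perm X

namespace InvertibleAutomaton

variable {Q X : Type*} (A : InvertibleAutomaton Q X)

/-- The transformation of the words of length `n` defined by the state `q`: the first letter `x`
is replaced by the output of `q` at `x`, and the rest of the word is processed from the state
that is the restriction of `q` at `x`. -/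
def act : (n : ℕ) → Q → (Fin n → X) → (Fin n → X)
  | 0, _, w => w
  | n + 1, q, w => Fin.cons (A.out q (w 0)) (act n (A.restr q (w 0)) (Fin.tail w))

theorem act_bijective (n : ℕ) (q : Q) : Function.Bijective (A.act n q) := by
  induction n generalizing q with
  | zero => exact Function.bijective_id
  | succ n ih =>
    constructor
    · intro u v h
      have h' := Fin.cons_inj.mp h
      have h0 : u 0 = v 0 := (A.out q).injective h'.1
      have h1 : Fin.tail u = Fin.tail v := by
        have h2 := h'.2
        rw [h0] at h2
        exact (ih _).1 h2
      rw [← Fin.cons_self_tail u, ← Fin.cons_self_tail v, h0, h1]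
    · intro v
      obtain ⟨w, hw⟩ := (ih (A.restr q ((A.out q).symm (v 0)))).2 (Fin.tail v)
      refine ⟨Fin.cons ((A.out q).symm (v 0)) w, ?_⟩
      simp [act, hw]

/-- The permutation of the words of length `n` defined by a state. -/
noncomputable def actPerm (n : ℕ) (q : Q) : Equiv.Perm (Fin n → X) :=
  Equiv.ofBijective (A.act n q) (A.act_bijective n q)

/-- The `n`-th Schreier graph, with directions, labels, loops and multiple edges: its vertices are
the words of length `n`, and every state `q` and word `u` give an edge from `u` to `q(u)` that is
labelled by `q`. -/
abbrev LabelledSchreierGraph (n : ℕ) : Type _ :=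
  Quiver.SchreierGraph (Fin n → X) (A.actPerm n)

/-- The simple graph that underlies the `n`-th Schreier graph: directions, labels, loops and
multiplicities of edges, which are irrelevant for distances, are forgotten. -/
def schreierGraph (n : ℕ) : SimpleGraph (Fin n → X) :=
  SimpleGraph.fromRel fun u v =>
    Nonempty ((⟨u⟩ : A.LabelledSchreierGraph n) ⟶ (⟨v⟩ : A.LabelledSchreierGraph n))

end InvertibleAutomaton

/-- A choice of an orientation for every edge of `G`. -/
structure EdgeOrientation {V : Type*} (G : SimpleGraph V) where
  /-- the set of oriented edges -/
  arcs : Set (V × V)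
  adj_of_mem : ∀ x y, (x, y) ∈ arcs → G.Adj x y
  mem_or_mem : ∀ x y, G.Adj x y → (x, y) ∈ arcs ∨ (y, x) ∈ arcs
  not_both : ∀ x y, (x, y) ∈ arcs → (y, x) ∉ arcs

/-- The automaton of the graph `G` with the chosen orientation of its edges. Its alphabet is the
vertex set of `G`. Its states are the oriented edges and a sink `none`, which acts trivially. The
state `e = (x, y)` exchanges the letters `x` and `y` and fixes all others; its restriction at `x`
is `e`, and its restriction at any other letter is the sink. -/
def graphAutomaton {V : Type*} [DecidableEq V] {G : SimpleGraph V} (o : EdgeOrientation G) :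
    InvertibleAutomaton (Option o.arcs) V where
  restr
    | none, _ => none
    | some e, z => if z = e.1.1 then some e else none
  out
    | none => Equiv.refl V
    | some e => Equiv.swap e.1.1 e.1.2

/-- The Wiener index: the sum of the distances over all unordered pairs of vertices, that is,
half of the sum over all ordered pairs. -/
noncomputable def wienerIndex {V : Type*} [Fintype V] (G : SimpleGraph V) : ℚ :=
  (1 / 2) * ∑ u : V, ∑ v : V, (G.dist u v : ℚ)

end GraphAutomaton

/-! The graph at level `n + 1` is the subdivision of the graph at level `n`, loops with label `x ≠
c` included: `w` becomes `cw`, and the edge labelled `x` from `w` to `shift c x n w` becomes the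
path from `cw` through the midpoint `xw` to `c (shift c x n w)`. A loop becomes a double edge to a
pendant vertex. Distances between old vertices double, and a midpoint is left through one of its two
ends; this is the recursion `wordDist`.

Summing it requires the minimum of the four distances between the ends of two edges. Distances
change by exactly one along every non-loop edge (`wordDist_shift`), so four times this minimum is a
linear expression plus `defect` (`four_mul_min_wordDist`). The defect is 2 if the edges are in the
Djoković–Winkler relation and 0 otherwise. In a cactus with even cycles an edge is related only to
itself and to the opposite edge of its cycle, which predicts a total of 4 per non-loop edge;
`sum_defect` obtains this total directly by induction along the subdivision. The result is a linear
recurrence, `totalWordDist_succ`, whose solution is the formula. -/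

namespace GraphAutomaton

/-! ### Distances under repeated subdivision -/

section WordDist

variable {V : Type*} [DecidableEq V]

/-- The transformation of the words of length `n` given by the arc from `x` to the centre `c`. -/
def shift (c x : V) : (n : ℕ) → (Fin n → V) → (Fin n → V)
  | 0, w => w
  | n + 1, w =>
    if w 0 = x then Fin.cons c (shift c x n (Fin.tail w))
    else if w 0 = c then Fin.cons x (Fin.tail w) else w

theorem shift_cons_self (c x : V) {n : ℕ} (w : Fin n → V) :
    shift c x (n + 1) (Fin.cons x w) = Fin.cons c (shift c x n w) := by
  simp [shift]

theorem shift_cons_center {c x : V} (h : x ≠ c) {n : ℕ} (w : Fin n → V) :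
    shift c x (n + 1) (Fin.cons c w) = Fin.cons x w := by
  simp [shift, h.symm]

theorem shift_cons_of_ne {c x z : V} (hx : z ≠ x) (hc : z ≠ c) {n : ℕ} (w : Fin n → V) :
    shift c x (n + 1) (Fin.cons z w) = Fin.cons z w := by
  simp [shift, hx, hc]

@[simp]
theorem shift_center (c : V) {n : ℕ} (w : Fin n → V) : shift c c n w = w := by
  induction n with
  | zero => rfl
  | succ n ih =>
    cases w using Fin.consCases with
    | cons z w =>
      by_cases hz : z = c
      · subst hz; rw [shift_cons_self, ih]
      · rw [shift_cons_of_ne hz hz]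

theorem shift_injective (c x : V) (n : ℕ) : Function.Injective (shift c x n) := by
  induction n with
  | zero => exact Function.injective_id
  | succ n ih =>
    intro u v h
    rw [← Fin.cons_self_tail u, ← Fin.cons_self_tail v] at h ⊢
    generalize u 0 = y, Fin.tail u = u, v 0 = z, Fin.tail v = v at *
    by_cases hx : x = c
    · subst hx; simpa using h
    by_cases hy : y = x <;> by_cases hyc : y = c <;> by_cases hz : z = x <;>
      by_cases hzc : z = c <;> simp_all [shift, Fin.cons_inj, ih.eq_iff]

theorem shift_bijective [Finite V] (c x : V) (n : ℕ) : Function.Bijective (shift c x n) :=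
  Finite.injective_iff_bijective.mp (shift_injective c x n)

/-- The distance of two words of length `n`, by recursion on the first letter. -/
def wordDist (c : V) : (n : ℕ) → (Fin n → V) → (Fin n → V) → ℕ
  | 0, _, _ => 0
  | n + 1, u, v =>
    if u = v then 0 else
      (if u 0 = c then 0 else 1) + (if v 0 = c then 0 else 1) + 2 *
        min (min (wordDist c n (Fin.tail u) (Fin.tail v))
            (wordDist c n (shift c (u 0) n (Fin.tail u)) (Fin.tail v)))
          (min (wordDist c n (Fin.tail u) (shift c (v 0) n (Fin.tail v)))
            (wordDist c n (shift c (u 0) n (Fin.tail u)) (shift c (v 0) n (Fin.tail v))))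

theorem wordDist_cons (c y z : V) {n : ℕ} (u v : Fin n → V) :
    wordDist c (n + 1) (Fin.cons y u) (Fin.cons z v) =
      if y = z ∧ u = v then 0 else
        (if y = c then 0 else 1) + (if z = c then 0 else 1) + 2 *
          min (min (wordDist c n u v) (wordDist c n (shift c y n u) v))
            (min (wordDist c n u (shift c z n v))
              (wordDist c n (shift c y n u) (shift c z n v))) := by
  simp [wordDist, Fin.cons_inj]

@[simp]
theorem wordDist_self (c : V) {n : ℕ} (u : Fin n → V) : wordDist c n u u = 0 := by
  cases n <;> simp [wordDist]

theorem wordDist_comm (c : V) {n : ℕ} (u v : Fin n → V) :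
    wordDist c n u v = wordDist c n v u := by
  induction n with
  | zero => rfl
  | succ n ih =>
    rw [wordDist, wordDist]
    simp only [eq_comm (a := u), ih (Fin.tail u), ih (shift c (u 0) n (Fin.tail u))]
    split_ifs <;> first | rfl | omega

theorem wordDist_cons_center (c y : V) {n : ℕ} (u v : Fin n → V) :
    wordDist c (n + 1) (Fin.cons y u) (Fin.cons c v) =
      (if y = c then 0 else 1) +
        2 * min (wordDist c n u v) (wordDist c n (shift c y n u) v) := by
  rw [wordDist_cons]
  rw [if_pos (rfl : c = c)]
  split_ifs with h1 h2 h2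
  · simp [h1.2]
  · exact absurd h1.1 h2
  · subst h2; simp
  · simp

theorem wordDist_cons_of_ne {c x : V} (hx : x ≠ c) {n : ℕ} (u : Fin (n + 1) → V)
    (v : Fin n → V) (h : u ≠ Fin.cons x v) :
    wordDist c (n + 1) u (Fin.cons x v) = 1 +
      min (wordDist c (n + 1) u (Fin.cons c v))
        (wordDist c (n + 1) u (Fin.cons c (shift c x n v))) := by
  cases u using Fin.consCases with
  | cons y u =>
    rw [wordDist_cons_center, wordDist_cons_center, wordDist_cons,
      if_neg (fun h' => h (Fin.cons_inj.mpr h')), if_neg hx]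
    omega

/-- Bipartiteness. By induction the distances to the two ends of a subdivided edge differ by 0 or 2,
and the midpoint lies one above the smaller. -/
theorem wordDist_shift (c : V) {n : ℕ} (u v : Fin n → V) (x : V) (h : shift c x n v ≠ v) :
    wordDist c n u v = wordDist c n u (shift c x n v) + 1 ∨
      wordDist c n u (shift c x n v) = wordDist c n u v + 1 := by
  induction n generalizing x with
  | zero => exact absurd rfl h
  | succ n ih =>
    have hx : x ≠ c := by rintro rfl; simp at h
    have key : ∀ w : Fin n → V,
        (wordDist c (n + 1) u (Fin.cons x w) = wordDist c (n + 1) u (Fin.cons c w) + 1 ∨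
          wordDist c (n + 1) u (Fin.cons c w) = wordDist c (n + 1) u (Fin.cons x w) + 1) ∧
        (wordDist c (n + 1) u (Fin.cons x w) =
            wordDist c (n + 1) u (Fin.cons c (shift c x n w)) + 1 ∨
          wordDist c (n + 1) u (Fin.cons c (shift c x n w)) =
            wordDist c (n + 1) u (Fin.cons x w) + 1) := by
      intro w
      by_cases hu : u = Fin.cons x w
      · subst hu
        simp [wordDist_cons_center, hx]
      · have h1 := wordDist_cons_of_ne hx u w hu
        cases u using Fin.consCases with
        | cons y u =>
          rw [wordDist_cons_center, wordDist_cons_center] at *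
          by_cases hw : shift c x n w = w
          · rw [hw] at h1 ⊢
            omega
          · have h2 := ih u w x hw
            have h3 := ih (shift c y n u) w x hw
            omega
    cases v using Fin.consCases with
    | cons z v =>
      by_cases hzx : z = x
      · subst hzx
        rw [shift_cons_self]
        exact (key v).2
      · by_cases hzc : z = c
        · subst hzc
          rw [shift_cons_center hx]
          exact (key v).1.symm
        · exact absurd (shift_cons_of_ne hzx hzc v) h

/-- Two words are neighbours if one is the image of the other under the shift along an arc. -/
def ShiftAdj (c : V) (n : ℕ) (u v : Fin n → V) : Prop :=
  u ≠ v ∧ ∃ x, x ≠ c ∧ (shift c x n u = v ∨ shift c x n v = u)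

theorem ShiftAdj.symm {c : V} {n : ℕ} {u v : Fin n → V} (h : ShiftAdj c n u v) :
    ShiftAdj c n v u :=
  ⟨h.1.symm, h.2.imp fun _ hx => ⟨hx.1, hx.2.symm⟩⟩

theorem ShiftAdj.wordDist_eq {c : V} {n : ℕ} {v w : Fin n → V} (h : ShiftAdj c n v w)
    (u : Fin n → V) :
    wordDist c n u v = wordDist c n u w + 1 ∨ wordDist c n u w = wordDist c n u v + 1 := by
  obtain ⟨hne, x, -, rfl | rfl⟩ := h
  · exact wordDist_shift c u v x hne.symm
  · exact (wordDist_shift c u w x hne).symm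

theorem shiftAdj_cons_center {c x : V} (hx : x ≠ c) {n : ℕ} (w : Fin n → V) :
    ShiftAdj c (n + 1) (Fin.cons x w) (Fin.cons c w) :=
  ⟨fun h => hx (Fin.cons_inj.mp h).1, x, hx, Or.inr (shift_cons_center hx w)⟩

theorem shiftAdj_cons_center_shift {c x : V} (hx : x ≠ c) {n : ℕ} (w : Fin n → V) :
    ShiftAdj c (n + 1) (Fin.cons x w) (Fin.cons c (shift c x n w)) :=
  ⟨fun h => hx (Fin.cons_inj.mp h).1, x, hx, Or.inl (shift_cons_self c x w)⟩

theorem exists_shiftAdj_wordDist_lt (c : V) {n : ℕ} (u v : Fin n → V) (h : u ≠ v) :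
    ∃ w, ShiftAdj c n v w ∧ wordDist c n u w < wordDist c n u v := by
  induction n with
  | zero => exact absurd (Subsingleton.elim u v) h
  | succ n ih =>
    cases v using Fin.consCases with
    | cons z v =>
      by_cases hz : z = c
      · subst hz
        cases u using Fin.consCases with
        | cons y u =>
          by_cases hyc : y ≠ z ∧ (u = v ∨ shift z y n u = v)
          · obtain ⟨hy, rfl | rfl⟩ := hyc
            · exact ⟨_, (shiftAdj_cons_center hy u).symm, by
                simp [wordDist_cons_center, hy]⟩
            · exact ⟨_, (shiftAdj_cons_center_shift hy u).symm, by
                simp [wordDist_cons_center, hy]⟩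
          -- `u'` is the end of the edge under `u` that is nearest to `v`. The descent from `v`
          -- towards `u'` one level down goes along an edge whose midpoint is the required
          -- neighbour.
          · obtain ⟨u', hu', hne, hmin⟩ : ∃ u', (u' = u ∨ u' = shift z y n u) ∧ u' ≠ v ∧
                wordDist z n u' v = min (wordDist z n u v) (wordDist z n (shift z y n u) v) := by
              by_cases hy : y = z
              · subst hy
                exact ⟨u, Or.inl rfl, fun h' => h (by rw [h']), by simp⟩
              · rcases le_total (wordDist z n u v) (wordDist z n (shift z y n u) v) with hl | hl
                · exact ⟨u, Or.inl rfl, fun h' => hyc ⟨hy, Or.inl h'⟩, by simp [hl]⟩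
                · exact ⟨_, Or.inr rfl, fun h' => hyc ⟨hy, Or.inr h'⟩, by simp [hl]⟩
            obtain ⟨w, ⟨hvw, x, hx, hs⟩, hlt⟩ := ih u' v hne
            have hw : min (wordDist z n u w) (wordDist z n (shift z y n u) w) ≤
                wordDist z n u' w := by
              rcases hu' with rfl | rfl
              · exact min_le_left _ _
              · exact min_le_right _ _
            have main : ∀ m : Fin n → V, (m = w ∨ shift z x n m = w) →
                wordDist z (n + 1) (Fin.cons y u) (Fin.cons x m) <
                  wordDist z (n + 1) (Fin.cons y u) (Fin.cons z v) := by
              intro m hm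
              by_cases hum : (Fin.cons y u : Fin (n + 1) → V) = Fin.cons x m
              · obtain ⟨rfl, rfl⟩ := Fin.cons_inj.mp hum
                rw [wordDist_self, wordDist_cons_center, if_neg hx]
                omega
              · rw [wordDist_cons_of_ne hx _ _ hum, wordDist_cons_center, wordDist_cons_center,
                  wordDist_cons_center]
                rcases hm with rfl | rfl <;> omega
            rcases hs with hs | hs
            · exact ⟨_, (shiftAdj_cons_center hx v).symm, main v (Or.inr hs)⟩
            · refine ⟨Fin.cons x w, ?_, main w (Or.inl rfl)⟩
              rw [← hs]
              exact (shiftAdj_cons_center_shift hx w).symm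
      · have h1 := wordDist_cons_of_ne hz u v h
        rcases le_total (wordDist c (n + 1) u (Fin.cons c v))
          (wordDist c (n + 1) u (Fin.cons c (shift c z n v))) with hl | hl
        · exact ⟨_, shiftAdj_cons_center hz v, by omega⟩
        · exact ⟨_, shiftAdj_cons_center_shift hz v, by omega⟩

end WordDist

/-- If `d u` decreases along some edge at every vertex other than `u`, then it bounds the distance
to `u` from above. -/
theorem exists_walk_of_forall_exists_adj_lt {W : Type*} {G : SimpleGraph W} {d : W → W → ℕ}
    (h : ∀ u v, u ≠ v → ∃ w, G.Adj v w ∧ d u w < d u v) (u v : W) :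
    ∃ p : G.Walk v u, p.length ≤ d u v := by
  induction hm : d u v using Nat.strong_induction_on generalizing v with
  | _ m ih =>
    by_cases huv : u = v
    · subst huv
      exact ⟨.nil, by simp⟩
    · obtain ⟨w, hw, hlt⟩ := h u v huv
      obtain ⟨p, hp⟩ := ih _ (hm ▸ hlt) w rfl
      exact ⟨.cons hw p, by simp only [SimpleGraph.Walk.length_cons]; omega⟩

theorem le_length_of_forall_adj_le {W : Type*} {G : SimpleGraph W} {d : W → W → ℕ}
    (h0 : ∀ u, d u u = 0) (h : ∀ u v w, G.Adj v w → d u v ≤ d u w + 1) {u v : W}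
    (p : G.Walk v u) : d u v ≤ p.length := by
  induction p with
  | nil => simp [h0]
  | cons hvw p ih =>
    simp only [SimpleGraph.Walk.length_cons]
    exact (h _ _ _ hvw).trans (Nat.add_le_add_right ih 1)

/-! ### The Schreier graph and its metric -/

section Schreier

variable {V : Type*} [DecidableEq V] {c : V} (o : EdgeOrientation (SimpleGraph.starGraph c))

theorem act_none (n : ℕ) (w : Fin n → V) : (graphAutomaton o).act n none w = w := by
  induction n with
  | zero => rfl
  | succ n ih =>
    rw [InvertibleAutomaton.act]
    refine Eq.trans ?_ (Fin.cons_self_tail w)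
    exact congrArg (Fin.cons (α := fun _ => V) (w 0)) (ih (Fin.tail w))

theorem act_cons_fst (e : o.arcs) {n : ℕ} (w : Fin n → V) :
    (graphAutomaton o).act (n + 1) (some e) (Fin.cons e.1.1 w) =
      Fin.cons e.1.2 ((graphAutomaton o).act n (some e) w) := by
  rw [InvertibleAutomaton.act]
  simp [graphAutomaton]

theorem act_cons_of_ne (e : o.arcs) {z : V} (hz : z ≠ e.1.1) {n : ℕ} (w : Fin n → V) :
    (graphAutomaton o).act (n + 1) (some e) (Fin.cons z w) =
      Fin.cons (Equiv.swap e.1.1 e.1.2 z) w := by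
  have h : (graphAutomaton o).restr (some e) z = none := if_neg hz
  rw [InvertibleAutomaton.act]
  simp only [Fin.cons_zero, Fin.tail_cons, h, act_none]
  rfl

theorem act_eq_shift {x : V} (hx : x ≠ c) (h : (x, c) ∈ o.arcs) (n : ℕ) (w : Fin n → V) :
    (graphAutomaton o).act n (some ⟨(x, c), h⟩) w = shift c x n w := by
  induction n with
  | zero => rfl
  | succ n ih =>
    cases w using Fin.consCases with
    | cons z w =>
      by_cases hzx : z = x
      · subst hzx
        rw [shift_cons_self, ← ih]
        exact act_cons_fst o ⟨(z, c), h⟩ w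
      · rw [act_cons_of_ne o ⟨(x, c), h⟩ hzx]
        by_cases hzc : z = c
        · subst hzc
          rw [shift_cons_center hx, Equiv.swap_apply_right]
        · rw [shift_cons_of_ne hzx hzc, Equiv.swap_apply_of_ne_of_ne hzx hzc]

/-- Reversing an arc inverts its action, so the undirected graph does not depend on the orientation.
-/
theorem act_shift {x : V} (hx : x ≠ c) (h : (c, x) ∈ o.arcs) (n : ℕ) (w : Fin n → V) :
    (graphAutomaton o).act n (some ⟨(c, x), h⟩) (shift c x n w) = w := by
  induction n with
  | zero => rfl
  | succ n ih =>
    cases w using Fin.consCases with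
    | cons z w =>
      by_cases hzx : z = x
      · subst hzx
        rw [shift_cons_self]
        refine (act_cons_fst o ⟨(c, z), h⟩ _).trans ?_
        rw [ih]
      · by_cases hzc : z = c
        · subst hzc
          rw [shift_cons_center hx, act_cons_of_ne o ⟨(z, x), h⟩ hx, Equiv.swap_apply_right]
        · rw [shift_cons_of_ne hzx hzc, act_cons_of_ne o ⟨(c, x), h⟩ hzc,
            Equiv.swap_apply_of_ne_of_ne hzc hzx]

theorem nonempty_hom_iff (n : ℕ) (u v : Fin n → V) :
    Nonempty ((⟨u⟩ : (graphAutomaton o).LabelledSchreierGraph n) ⟶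
      (⟨v⟩ : (graphAutomaton o).LabelledSchreierGraph n)) ↔
      ∃ q, (graphAutomaton o).act n q u = v := by
  constructor
  · rintro ⟨q, hq⟩
    exact ⟨q, congrArg Quiver.SchreierGraph.toVertex hq⟩
  · rintro ⟨q, hq⟩
    exact ⟨⟨q, congrArg Quiver.SchreierGraph.ofVertex hq⟩⟩

theorem schreierGraph_adj_iff [Finite V] (n : ℕ) (u v : Fin n → V) :
    ((graphAutomaton o).schreierGraph n).Adj u v ↔ ShiftAdj c n u v := by
  have forward : ∀ u v : Fin n → V, u ≠ v → (∃ q, (graphAutomaton o).act n q u = v) →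
      ShiftAdj c n u v := by
    rintro u v hne ⟨_ | ⟨⟨y, z⟩, h⟩, hq⟩
    · exact absurd ((act_none o n u).symm.trans hq) hne
    · obtain ⟨hyz, rfl | rfl⟩ := SimpleGraph.starGraph_adj.mp (o.adj_of_mem y z h)
      · refine ⟨hne, z, hyz.symm, Or.inr ?_⟩
        obtain ⟨t, rfl⟩ := (shift_bijective y z n).2 u
        rw [act_shift o hyz.symm h] at hq
        rw [hq]
      · exact ⟨hne, y, hyz, Or.inl ((act_eq_shift o hyz h n u).symm.trans hq)⟩
  rw [InvertibleAutomaton.schreierGraph, SimpleGraph.fromRel_adj, nonempty_hom_iff,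
    nonempty_hom_iff]
  constructor
  · rintro ⟨hne, h | h⟩
    · exact forward u v hne h
    · exact (forward v u hne.symm h).symm
  · rintro ⟨hne, x, hx, h⟩
    refine ⟨hne, ?_⟩
    rcases o.mem_or_mem x c (SimpleGraph.starGraph_adj.mpr ⟨hx, Or.inr rfl⟩) with ho | ho
    · exact h.imp (fun h => ⟨_, (act_eq_shift o hx ho n u).trans h⟩)
        fun h => ⟨_, (act_eq_shift o hx ho n v).trans h⟩
    · exact h.symm.imp (fun h => ⟨_, h ▸ act_shift o hx ho n v⟩)
        fun h => ⟨_, h ▸ act_shift o hx ho n u⟩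

theorem exists_walk_length_le_wordDist [Finite V] (n : ℕ) (u v : Fin n → V) :
    ∃ p : ((graphAutomaton o).schreierGraph n).Walk v u, p.length ≤ wordDist c n u v :=
  exists_walk_of_forall_exists_adj_lt (fun u v h => by
    simpa only [schreierGraph_adj_iff] using exists_shiftAdj_wordDist_lt c u v h) u v

theorem schreierGraph_connected [Finite V] (n : ℕ) :
    ((graphAutomaton o).schreierGraph n).Connected :=
  haveI : Nonempty (Fin n → V) := ⟨fun _ => c⟩
  ⟨fun u v => (exists_walk_length_le_wordDist o n v u).elim fun p _ => p.reachable⟩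

/-- Descent along neighbours bounds the distance from above; changing by one along each edge bounds
it from below. -/
theorem schreierGraph_dist [Finite V] (n : ℕ) (u v : Fin n → V) :
    ((graphAutomaton o).schreierGraph n).dist u v = wordDist c n u v := by
  rw [SimpleGraph.dist_comm]
  apply le_antisymm
  · obtain ⟨p, hp⟩ := exists_walk_length_le_wordDist o n u v
    exact (SimpleGraph.dist_le p).trans hp
  · obtain ⟨p, hp⟩ := ((schreierGraph_connected o n).preconnected v u).exists_walk_length_eq_dist
    rw [← hp]
    refine le_length_of_forall_adj_le (fun u => wordDist_self c u) (fun u v w h => ?_) p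
    have := ((schreierGraph_adj_iff o n v w).mp h).wordDist_eq u
    omega

end Schreier

/-! ### Minima over pairs of edges, and their defects -/

section Sums

theorem sum_words_succ {V : Type*} [Fintype V] {M : Type*} [AddCommMonoid M] (n : ℕ)
    (f : (Fin (n + 1) → V) → M) :
    ∑ u, f u = ∑ x : V, ∑ w : Fin n → V, f (Fin.cons x w) := by
  rw [← (Fin.consEquiv fun _ => V).sum_comp, Fintype.sum_prod_type]
  rfl

variable {V : Type*} [DecidableEq V]

/-- The indicator of the words that are moved by the shift along the arc of `x`. -/
def moved (c x : V) {n : ℕ} (w : Fin n → V) : ℤ := if shift c x n w = w then 0 else 1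

/-- The absolute value of the alternating sum of the distances of the end points of two edges. -/
def defect (c x : V) {n : ℕ} (u : Fin n → V) (y : V) (v : Fin n → V) : ℤ :=
  |(wordDist c n u v : ℤ) - wordDist c n (shift c x n u) v - wordDist c n u (shift c y n v)
    + wordDist c n (shift c x n u) (shift c y n v)|

/-- For each of the two edges, either both end points coincide or the distances to the end points
differ by one. -/
theorem wordDist_shift_cases (c x : V) {n : ℕ} (u v : Fin n → V) :
    (moved c x v = 0 ∧ wordDist c n u (shift c x n v) = wordDist c n u v) ∨
      (moved c x v = 1 ∧ (wordDist c n u v = wordDist c n u (shift c x n v) + 1 ∨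
        wordDist c n u (shift c x n v) = wordDist c n u v + 1)) := by
  by_cases h : shift c x n v = v
  · exact Or.inl ⟨if_pos h, by rw [h]⟩
  · exact Or.inr ⟨if_neg h, wordDist_shift c u v x h⟩

/-- For two non-loops with minimum `m`, the four distances are `m, m+1, m+1, m+2` with defect 0, or
`m, m, m+1, m+1` with defect 0 or 2 excluded by parity except as `m, m+1, m+1, m` around the square,
with defect 2. -/
theorem four_mul_min_wordDist (c x y : V) {n : ℕ} (u v : Fin n → V) :
    4 * ((min (min (wordDist c n u v) (wordDist c n (shift c x n u) v))
          (min (wordDist c n u (shift c y n v))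
            (wordDist c n (shift c x n u) (shift c y n v))) : ℕ) : ℤ) =
      wordDist c n u v + wordDist c n (shift c x n u) v + wordDist c n u (shift c y n v)
        + wordDist c n (shift c x n u) (shift c y n v) - 2 * moved c x u - 2 * moved c y v
        + defect c x u y v := by
  have h1 := wordDist_shift_cases c y u v
  have h2 := wordDist_shift_cases c y (shift c x n u) v
  have h3 := wordDist_shift_cases c x v u
  have h4 := wordDist_shift_cases c x (shift c y n v) u
  rw [wordDist_comm c v, wordDist_comm c v] at h3
  rw [wordDist_comm c (shift c y n v), wordDist_comm c (shift c y n v)] at h4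
  rw [defect, Int.abs_eq_natAbs]
  omega

/-- The last term corrects the diagonal, where leaving a midpoint and returning would count 2
instead of 0. -/
theorem two_mul_wordDist_cons (c x y : V) {n : ℕ} (u v : Fin n → V) :
    2 * (wordDist c (n + 1) (Fin.cons x u) (Fin.cons y v) : ℤ) =
      2 * (if x = c then 0 else 1) + 2 * (if y = c then 0 else 1)
        + (wordDist c n u v + wordDist c n (shift c x n u) v + wordDist c n u (shift c y n v)
        + wordDist c n (shift c x n u) (shift c y n v)) - 2 * moved c x u - 2 * moved c y v
        + defect c x u y v - (if x = y then if u = v then 4 * if x = c then 0 else 1 else 0 else 0)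
    := by
  have h := four_mul_min_wordDist c x y u v
  rw [wordDist_cons]
  by_cases hxy : x = y
  · by_cases huv : u = v
    · subst hxy huv
      rw [wordDist_self] at h ⊢
      simp only [and_self, if_true]
      push_cast at h ⊢
      split_ifs <;> omega
    · simp only [hxy, huv, and_false, if_false, if_true] at h ⊢
      split_ifs <;> omega
  · simp only [hxy, false_and, if_false]
    split_ifs <;> omega

theorem sum_shift [Fintype V] {M : Type*} [AddCommMonoid M] (c x : V) (n : ℕ)
    (f : (Fin n → V) → M) : ∑ w, f (shift c x n w) = ∑ w, f w :=
  (shift_bijective c x n).sum_comp f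

theorem sum_ne_center [Fintype V] (c : V) :
    ∑ x : V, (if x = c then (0 : ℤ) else 1) = Fintype.card V - 1 := by
  have h : ∀ x : V, (if x = c then (0 : ℤ) else 1) = 1 - if x = c then 1 else 0 := by
    intro x; split_ifs <;> rfl
  simp [h]

/-- The number of pairs of a label and a word that is moved by the shift with this label. -/
theorem sum_moved_succ [Fintype V] (c : V) (n : ℕ) :
    ∑ x : V, ∑ u : Fin (n + 1) → V, moved c x u =
      2 * (Fintype.card V - 1) * (Fintype.card V : ℤ) ^ n := by
  have key : ∀ x : V, ∑ u : Fin (n + 1) → V, moved c x u =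
      (if x = c then 0 else 1) * (2 * (Fintype.card V : ℤ) ^ n) := by
    intro x
    by_cases hx : x = c
    · simp [moved, hx]
    -- Only words starting with `x` or `c` move; they index the two halves of a subdivided edge.
    · rw [sum_words_succ, Fintype.sum_eq_add x c hx]
      · have h1 : ∀ w : Fin n → V, moved c x (Fin.cons x w : Fin (n + 1) → V) = 1 := fun w =>
          if_neg (by rw [shift_cons_self, Fin.cons_inj]; exact fun h => hx h.1.symm)
        have h2 : ∀ w : Fin n → V, moved c x (Fin.cons c w : Fin (n + 1) → V) = 1 := fun w =>
          if_neg (by rw [shift_cons_center hx, Fin.cons_inj]; exact fun h => hx h.1)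
        simp [h1, h2, hx]
        ring
      · exact fun z hz => Finset.sum_eq_zero fun w _ => if_pos (shift_cons_of_ne hz.1 hz.2 w)
  simp_rw [key, ← Finset.sum_mul, sum_ne_center]
  ring

theorem defect_center_left (c y : V) {n : ℕ} (u v : Fin n → V) : defect c c u y v = 0 := by
  simp [defect]

theorem defect_center_right (c x : V) {n : ℕ} (u v : Fin n → V) : defect c x u c v = 0 := by
  simp [defect]

/-- Each of two edges is subdivided; this is the total defect of the pairs of halves. -/
theorem defect_halves {c x y : V} (hx : x ≠ c) (hy : y ≠ c) {n : ℕ} (u v : Fin n → V) :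
    defect c x (Fin.cons x u : Fin (n + 1) → V) y (Fin.cons y v)
      + defect c x (Fin.cons x u : Fin (n + 1) → V) y (Fin.cons c v)
      + (defect c x (Fin.cons c u : Fin (n + 1) → V) y (Fin.cons y v)
      + defect c x (Fin.cons c u : Fin (n + 1) → V) y (Fin.cons c v)) =
    2 * defect c x u y v + if x = y then if u = v then 8 * (1 - moved c x u) else 0 else 0 := by
  have h1 := wordDist_shift_cases c y u v
  have h2 := wordDist_shift_cases c y (shift c x n u) v
  have h3 := wordDist_shift_cases c x v u
  have h4 := wordDist_shift_cases c x (shift c y n v) u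
  have hc : ∀ w t : Fin n → V, wordDist c (n + 1) (Fin.cons c w) (Fin.cons y t) =
      1 + 2 * min (wordDist c n w t) (wordDist c n w (shift c y n t)) := fun w t => by
    rw [wordDist_comm, wordDist_cons_center, if_neg hy, wordDist_comm c t, wordDist_comm c _ w]
  rw [wordDist_comm c v, wordDist_comm c v] at h3
  rw [wordDist_comm c (shift c y n v), wordDist_comm c (shift c y n v)] at h4
  simp only [defect, Int.abs_eq_natAbs, shift_cons_self, shift_cons_center hx,
    shift_cons_center hy, wordDist_cons_center, hc, if_true, if_neg hx]
  rw [wordDist_cons]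
  simp only [if_neg hx, if_neg hy, shift_center, min_self]
  by_cases hxy : x = y
  · by_cases huv : u = v
    -- An edge against itself: a loop splits into a double edge, whose four pairs of halves have
    -- defect 2 each, hence the 8.
    · subst hxy huv
      have h5 := wordDist_comm c u (shift c x n u)
      simp only [wordDist_self, and_self, if_true] at *
      omega
    · simp only [hxy, huv, and_false, if_false, if_true] at *
      omega
  · simp only [hxy, false_and, if_false]
    omega

end Sums

/-! ### The recurrence and its solution -/

section Totals

theorem moved_center {V : Type*} [DecidableEq V] (c : V) {n : ℕ} (u : Fin n → V) :
    moved c c u = 0 := by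
  simp [moved]

variable {V : Type*} [DecidableEq V] [Fintype V]

theorem sum_defect_pair_succ (c x y : V) (n : ℕ) :
    ∑ u : Fin (n + 1) → V, ∑ v : Fin (n + 1) → V, defect c x u y v =
      ∑ u : Fin n → V, ∑ v : Fin n → V, (2 * defect c x u y v + if x = y then
        if u = v then 8 * ((if x = c then 0 else 1) - moved c x u) else 0 else 0) := by
  by_cases hx : x = c
  · subst hx
    simp [defect_center_left, moved_center]
  by_cases hy : y = c
  · subst hy
    simp [defect_center_right, hx]
  have hl : ∀ z, z ≠ x ∧ z ≠ c → ∀ w : Fin n → V, ∀ v : Fin (n + 1) → V,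
      defect c x (Fin.cons z w : Fin (n + 1) → V) y v = 0 := fun z hz w v => by
    simp [defect, shift_cons_of_ne hz.1 hz.2]
  have hr : ∀ z, z ≠ y ∧ z ≠ c → ∀ w : Fin n → V, ∀ u : Fin (n + 1) → V,
      defect c x u y (Fin.cons z w : Fin (n + 1) → V) = 0 := fun z hz w u => by
    simp [defect, shift_cons_of_ne hz.1 hz.2]
  have hv : ∀ u : Fin (n + 1) → V, ∑ v : Fin (n + 1) → V, defect c x u y v =
      ∑ v : Fin n → V, (defect c x u y (Fin.cons y v : Fin (n + 1) → V)
        + defect c x u y (Fin.cons c v : Fin (n + 1) → V)) := fun u => by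
    rw [sum_words_succ, Fintype.sum_eq_add y c hy, Finset.sum_add_distrib]
    exact fun z hz => Finset.sum_eq_zero fun w _ => hr z hz w u
  rw [sum_words_succ, Fintype.sum_eq_add x c hx]
  · simp_rw [hv]
    rw [← Finset.sum_add_distrib]
    refine Finset.sum_congr rfl fun u _ => ?_
    rw [← Finset.sum_add_distrib]
    refine Finset.sum_congr rfl fun v _ => ?_
    rw [defect_halves hx hy, if_neg hx]
  · exact fun z hz => Finset.sum_eq_zero fun w _ => Finset.sum_eq_zero fun v _ => hl z hz w v

/-- With `E` moved pairs at level `n` and `k` letters, subdivision gives `2 * 4E + 8((k-1)k^n - E) =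
8(k-1)k^n`, four times the number of moved pairs at level `n + 1`. -/
theorem sum_defect (c : V) (n : ℕ) :
    ∑ x : V, ∑ y : V, ∑ u : Fin n → V, ∑ v : Fin n → V, defect c x u y v =
      4 * ∑ x : V, ∑ u : Fin n → V, moved c x u := by
  induction n with
  | zero => simp [defect, moved, wordDist, shift]
  | succ n ih =>
    simp_rw [sum_defect_pair_succ, Finset.sum_add_distrib, ← Finset.mul_sum, ih, sum_moved_succ]
    have h : ∑ x : V, ∑ y : V, ∑ u : Fin n → V, ∑ v : Fin n → V, (if x = y then
        if u = v then 8 * ((if x = c then (0 : ℤ) else 1) - moved c x u) else 0 else 0) =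
        8 * ((Fintype.card V - 1) * (Fintype.card V : ℤ) ^ n)
          - 8 * ∑ x : V, ∑ u : Fin n → V, moved c x u := by
      have h1 : ∀ x y : V, ∑ u : Fin n → V, ∑ v : Fin n → V, (if x = y then
          if u = v then 8 * ((if x = c then (0 : ℤ) else 1) - moved c x u) else 0 else 0) =
          if x = y then ∑ u : Fin n → V, 8 * ((if x = c then (0 : ℤ) else 1) - moved c x u)
            else 0 := by
        intro x y
        split_ifs <;> simp
      simp_rw [h1, Finset.sum_ite_eq, Finset.mem_univ, if_true, ← Finset.mul_sum,
        Finset.sum_sub_distrib, Finset.sum_const, Finset.card_univ, nsmul_eq_mul,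
        ← Finset.mul_sum, sum_ne_center]
      simp
      ring
    rw [h]
    ring

/-- The sum of the distances over all ordered pairs of words. -/
def totalWordDist (c : V) (n : ℕ) : ℤ :=
  ∑ u : Fin n → V, ∑ v : Fin n → V, (wordDist c n u v : ℤ)

theorem totalWordDist_succ (c : V) (n : ℕ) :
    totalWordDist c (n + 1) =
      2 * (Fintype.card V : ℤ) ^ 2 * totalWordDist c n
        + 2 * Fintype.card V * (Fintype.card V - 1) * (Fintype.card V : ℤ) ^ (2 * n)
        - 2 * (Fintype.card V : ℤ) ^ (n + 1) * ∑ x : V, ∑ u : Fin n → V, moved c x u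
        + 2 * ∑ x : V, ∑ u : Fin n → V, moved c x u
        - 2 * (Fintype.card V - 1) * (Fintype.card V : ℤ) ^ n := by
  have h0 : ∑ u : Fin n → V, ∑ v : Fin n → V, (wordDist c n u v : ℤ) = totalWordDist c n := rfl
  have h1 : ∀ x, ∑ u : Fin n → V, ∑ v : Fin n → V, (wordDist c n (shift c x n u) v : ℤ) =
      totalWordDist c n := fun x =>
    sum_shift c x n fun u => ∑ v : Fin n → V, (wordDist c n u v : ℤ)
  have h2 : ∀ y u, ∑ v : Fin n → V, (wordDist c n u (shift c y n v) : ℤ) =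
      ∑ v : Fin n → V, (wordDist c n u v : ℤ) := fun y u =>
    sum_shift c y n fun v => (wordDist c n u v : ℤ)
  have he : ∀ x y : V, ∑ u : Fin n → V, ∑ v : Fin n → V, (if x = y then
      if u = v then 4 * (if x = c then (0 : ℤ) else 1) else 0 else 0) =
      if x = y then (Fintype.card V : ℤ) ^ n * (4 * if x = c then 0 else 1) else 0 := by
    intro x y
    by_cases h : x = y <;> simp [h]
  have key : 2 * totalWordDist c (n + 1) = ∑ x : V, ∑ y : V, ∑ u : Fin n → V, ∑ v : Fin n → V,
      2 * (wordDist c (n + 1) (Fin.cons x u) (Fin.cons y v) : ℤ) := by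
    rw [totalWordDist, sum_words_succ, Finset.mul_sum]
    refine Finset.sum_congr rfl fun x _ => ?_
    simp_rw [sum_words_succ, Finset.mul_sum]
    exact Finset.sum_comm
  simp only [two_mul_wordDist_cons, Finset.sum_sub_distrib, Finset.sum_add_distrib] at key
  simp only [h2, h1, h0, he, sum_defect] at key
  simp only [Finset.sum_ite_eq, Finset.mem_univ, if_true, Finset.sum_const, Finset.card_univ,
    nsmul_eq_mul, ← Finset.mul_sum, sum_ne_center, Fintype.card_pi, Finset.prod_const,
    Fintype.card_fin, Nat.cast_pow] at key
  have hn : (Fintype.card V : ℤ) ^ (2 * n) = ((Fintype.card V : ℤ) ^ n) ^ 2 := by ring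
  rw [hn, pow_succ _ n]
  linarith

theorem totalWordDist_zero (c : V) : totalWordDist c 0 = 0 := by
  simp [totalWordDist, wordDist]

theorem half_totalWordDist_succ (c : V) (n : ℕ) (k : ℚ) (hk : (Fintype.card V : ℚ) = k) :
    1 / 2 * (totalWordDist c (n + 1) : ℚ) =
      ((k - 1) ^ 2 * (2 * k ^ 2 - 2 * k - 1)) / (k ^ 3 * (2 * k - 1))
          * (2 ^ (n + 1) * k ^ (2 * (n + 1)))
        - ((k - 1) * (k - 2)) / k ^ 2 * k ^ (2 * (n + 1))
        + ((k - 1) * (k - 2)) / (k ^ 2 * (2 * k - 1)) * k ^ (n + 1) := by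
  have : Nonempty V := ⟨c⟩
  have hk1 : (1 : ℚ) ≤ k := by
    rw [← hk]
    exact_mod_cast Fintype.card_pos
  have hk0 : k ≠ 0 := by linarith
  have hk2 : 2 * k - 1 ≠ 0 := by linarith
  -- The induction starts at level 1: the count in `sum_moved_succ` holds only at positive levels,
  -- since nothing moves at level 0.
  induction n with
  | zero =>
    have h : (totalWordDist c 1 : ℚ) = 2 * (k - 1) ^ 2 := by
      rw [totalWordDist_succ, totalWordDist_zero]
      simp [moved, shift, hk]
      ring
    rw [h]
    field_simp
    ring
  | succ n ih =>
    have h : (totalWordDist c (n + 2) : ℚ) = 2 * k ^ 2 * totalWordDist c (n + 1)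
        + 2 * k * (k - 1) * k ^ (2 * (n + 1))
        - 2 * k ^ (n + 1 + 1) * (2 * (k - 1) * k ^ n)
        + 2 * (2 * (k - 1) * k ^ n) - 2 * (k - 1) * k ^ (n + 1) := by
      rw [totalWordDist_succ, sum_moved_succ]
      push_cast
      rw [hk]
    have h' : 1 / 2 * (totalWordDist c (n + 2) : ℚ) =
        2 * k ^ 2 * (1 / 2 * (totalWordDist c (n + 1) : ℚ))
        + k * (k - 1) * k ^ (2 * (n + 1))
        - k ^ (n + 1 + 1) * (2 * (k - 1) * k ^ n)
        + 2 * (k - 1) * k ^ n - (k - 1) * k ^ (n + 1) := by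
      rw [h]
      ring
    rw [h', ih]
    field_simp
    ring

end Totals

end GraphAutomaton

theorem mainTheorem11 {V : Type*} [Fintype V] [DecidableEq V] (c : V)
    (o : GraphAutomaton.EdgeOrientation (SimpleGraph.starGraph c))
    (k : ℕ) (hk : Fintype.card V = k) (n : ℕ) (hn : 1 ≤ n) :
    ((GraphAutomaton.graphAutomaton o).schreierGraph n).Connected ∧
      GraphAutomaton.wienerIndex ((GraphAutomaton.graphAutomaton o).schreierGraph n) =
        (((k : ℚ) - 1) ^ 2 * (2 * (k : ℚ) ^ 2 - 2 * (k : ℚ) - 1)) /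
            ((k : ℚ) ^ 3 * (2 * (k : ℚ) - 1)) * (2 ^ n * (k : ℚ) ^ (2 * n))
          - (((k : ℚ) - 1) * ((k : ℚ) - 2)) / (k : ℚ) ^ 2 * (k : ℚ) ^ (2 * n)
          + (((k : ℚ) - 1) * ((k : ℚ) - 2)) / ((k : ℚ) ^ 2 * (2 * (k : ℚ) - 1)) *
            (k : ℚ) ^ n := by
  refine ⟨GraphAutomaton.schreierGraph_connected o n, ?_⟩
  obtain ⟨m, rfl⟩ := Nat.exists_eq_add_of_le' hn
  rw [← GraphAutomaton.half_totalWordDist_succ c m k (by rw [hk])]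
  simp [GraphAutomaton.wienerIndex, GraphAutomaton.totalWordDist,
    GraphAutomaton.schreierGraph_dist]
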